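/- Let $G$ and $H$ be smooth real Lie groups (finite-dimensional or, more generally, modelled on Banach spaces) with identities $e_G$, $e_H$ and Lie algebras $\mathfrak g=T_{e_G}G$, $\mathfrak h=T_{e_H}H$. Let $\Phi:G\to\mathrm{Aut}(H)$ be an action of $G$ on $H$ by automorphisms, i.e. a group homomorphism such that $(g,h)\mapsto\Phi(g)h$ is smooth. A relative Rota-Baxter operator on $G$ with respect to $(H;\Phi)$ is a smooth map $\mathcal B:H\to G$ with $$\mathcal B(h_1)\,\mathcal B(h_2)=\mathcal B\big(h_1\,\Phi(\mathcal B(h_1))h_2\big)\qquad\text{for all } h_1,h_2\in H$$ (so that $\mathcal B(e_H)=e_G$). A homomorphism from $\mathcal B'$ to $\mathcal B$ is a pair of Lie group homomorphisms $\Psi_G:G\to G$, $\Psi_H:H\to H$ with $\mathcal B\circ\Psi_H=\Psi_G\circ\mathcal B'$ and $\Psi_H(\Phi(g)h)=\Phi(\Psi_G(g))\Psi_H(h)$ for all $g\in G$, $h\in H$. These form a category $\mathrm{RB}(G,H,\Phi)$. For a Lie algebra homomorphism $\phi:\mathfrak g\to\mathrm{Der}(\mathfrak h)$, a relative Rota-Baxter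 operator of weight $1$ on $\mathfrak g$ with respect to $(\mathfrak h;\phi)$ is a linear map $B:\mathfrak h\to\mathfrak g$ with $$[B(u),B(v)]_{\mathfrak g}=B\big(\phi(B(u))v-\phi(B(v))u+[u,v]_{\mathfrak h}\big)\qquad\text{for all } u,v\in\mathfrak h.$$ A homomorphism from $B'$ to $B$ is a pair of Lie algebra homomorphisms $\psi_{\mathfrak g}:\mathfrak g\to\mathfrak g$, $\psi_{\mathfrak h}:\mathfrak h\to\mathfrak h$ with $\psi_{\mathfrak g}\circ B'=B\circ\psi_{\mathfrak h}$ and $\psi_{\mathfrak h}(\phi(x)v)=\phi(\psi_{\mathfrak g}(x))\psi_{\mathfrak h}(v)$ for all $x\in\mathfrak g$, $v\in\mathfrak h$. These form a category $\mathrm{RB}(\mathfrak g,\mathfrak h,\phi)$. Then the map $\tilde\Phi: g\mapsto\Phi(g)_{*e_H}$ from $G$ to the bounded linear endomorphisms of $\mathfrak h$ is smooth, and its derivative at $e_G$ is a Lie algebra homomorphism $\phi=\tilde\Phi_{*e_G}:\mathfrak g\to\mathrm{Der}(\mathfrak h)$, the differentiated action. For every relative Rota-Baxter operator $\mathcal B$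 on $G$ with respect to $(H;\Phi)$, the tangent map $B=\mathcal B_{*e_H}:\mathfrak h\to\mathfrak g$ is a relative Rota-Baxter operator of weight $1$ on $\mathfrak g$ with respect to $(\mathfrak h;\phi)$. Moreover there is a functor $$\mathrm{Diff}:\mathrm{RB}(G,H,\Phi)\to\mathrm{RB}(\mathfrak g,\mathfrak h,\phi)$$ with $\mathrm{Diff}(\mathcal B)=\mathcal B_{*e_H}$ on objects and $\mathrm{Diff}(\Psi_G,\Psi_H)=\big((\Psi_G)_{*e_G},(\Psi_H)_{*e_H}\big)$ on homomorphisms. -/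

import Mathlib

open scoped Manifold ContDiff
open CategoryTheory

noncomputable section

/-- A smooth Lie group is regular enough for its tangent space at the identity to carry Mathlib's
Lie algebra structure (the bracket of left-invariant vector fields). -/
instance leInftyMinSmoothnessThree : ENat.LEInfty (minSmoothness ℝ 3) :=
  ⟨by rw [minSmoothness_of_isRCLikeNormedField]; exact ENat.LEInfty.out⟩

/-! ### Relative Rota-Baxter operators on Lie algebras -/

section LieAlgebras

variable {𝔤 𝔥 : Type*} [LieRing 𝔤] [LieAlgebra ℝ 𝔤] [LieRing 𝔥] [LieAlgebra ℝ 𝔥]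

/-- The linear map `B : 𝔥 → 𝔤` is a relative Rota-Baxter operator of weight `1` on `𝔤` with
respect to the action `φ : 𝔤 → Der(𝔥)`. -/
def IsRelRotaBaxter (φ : 𝔤 →ₗ⁅ℝ⁆ LieDerivation ℝ 𝔥 𝔥) (B : 𝔥 →ₗ[ℝ] 𝔤) : Prop :=
  ∀ u v : 𝔥, ⁅B u, B v⁆ = B (φ (B u) v - φ (B v) u + ⁅u, v⁆)

/-- The relative Rota-Baxter operators of weight `1` on `𝔤` with respect to `(𝔥; φ)`. -/
structure RelRotaBaxter (φ : 𝔤 →ₗ⁅ℝ⁆ LieDerivation ℝ 𝔥 𝔥) where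
  /-- the operator -/
  op : 𝔥 →ₗ[ℝ] 𝔤
  isRelRotaBaxter : IsRelRotaBaxter φ op

/-- The pair `(ψ𝔤, ψ𝔥)` is a homomorphism of relative Rota-Baxter operators from `B'` to `B`. -/
def IsRelRotaBaxterHom (φ : 𝔤 →ₗ⁅ℝ⁆ LieDerivation ℝ 𝔥 𝔥) (B' B : 𝔥 →ₗ[ℝ] 𝔤)
    (ψ𝔤 : 𝔤 →ₗ⁅ℝ⁆ 𝔤) (ψ𝔥 : 𝔥 →ₗ⁅ℝ⁆ 𝔥) : Prop :=
  (∀ u, ψ𝔤 (B' u) = B (ψ𝔥 u)) ∧ ∀ x v, ψ𝔥 (φ x v) = φ (ψ𝔤 x) (ψ𝔥 v)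

namespace RelRotaBaxter

variable {φ : 𝔤 →ₗ⁅ℝ⁆ LieDerivation ℝ 𝔥 𝔥}

/-- Homomorphisms of relative Rota-Baxter operators on Lie algebras. -/
@[ext]
structure Hom (B' B : RelRotaBaxter φ) where
  /-- the component on `𝔤` -/
  onTarget : 𝔤 →ₗ⁅ℝ⁆ 𝔤
  /-- the component on `𝔥` -/
  onSource : 𝔥 →ₗ⁅ℝ⁆ 𝔥
  isHom : IsRelRotaBaxterHom φ B'.op B.op onTarget onSource

/-- The category of relative Rota-Baxter operators on `𝔤` with respect to `(𝔥; φ)`. -/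
instance : Category (RelRotaBaxter φ) where
  Hom := Hom
  id B := ⟨LieHom.id, LieHom.id, fun _ => rfl, fun _ _ => rfl⟩
  comp f g :=
    { onTarget := g.onTarget.comp f.onTarget
      onSource := g.onSource.comp f.onSource
      isHom :=
        ⟨fun u => by
          rw [LieHom.comp_apply, LieHom.comp_apply, f.isHom.1, g.isHom.1],
         fun x v => by
          rw [LieHom.comp_apply, LieHom.comp_apply, LieHom.comp_apply, f.isHom.2, g.isHom.2]⟩ }

end RelRotaBaxter

end LieAlgebras

/-! ### Relative Rota-Baxter operators on Lie groups -/

section LieGroups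

variable {EG : Type*} [NormedAddCommGroup EG] [NormedSpace ℝ EG]
  {MG : Type*} [TopologicalSpace MG] (I : ModelWithCorners ℝ EG MG)
  {EH : Type*} [NormedAddCommGroup EH] [NormedSpace ℝ EH]
  {MH : Type*} [TopologicalSpace MH] (J : ModelWithCorners ℝ EH MH)
  (G : Type*) [TopologicalSpace G] [ChartedSpace MG G] [Group G]
  (H : Type*) [TopologicalSpace H] [ChartedSpace MH H] [Group H]

/-- An action `Φ : G → Aut(H)` of the Lie group `G` on the Lie group `H` by automorphisms, smooth
as a map `G × H → H`. -/
structure LieGroupAction where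
  /-- the homomorphism `G → Aut(H)` -/
  toHom : G →* MulAut H
  contMDiff_toHom : ContMDiff (I.prod J) J ∞ fun p : G × H => toHom p.1 p.2

variable {G H}

/-- The tangent map at the identity of a map `f : G → H` with `f 1 = 1`. Since `f 1 = 1`, the target
`T_{f 1} H` of `mfderiv` is the Lie algebra `T_1 H`; in Mathlib both are the model space `EH`, so no
transport is written. -/
def tangentAtOne (f : G → H) : GroupLieAlgebra I G →L[ℝ] GroupLieAlgebra J H :=
  mfderiv I J f 1

variable {I J}

namespace LieGroupAction

/-- The map `Φ̃ : G → Aut(𝔥) ⊆ L(𝔥, 𝔥)`, `g ↦ Φ(g)_{*e}`. The Lie algebra `𝔥` is written as the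
model space `EH`, to which it is equal in Mathlib, so that `L(𝔥, 𝔥)` carries the operator norm. -/
def tangentAut (Φ : LieGroupAction I J G H) (g : G) : EH →L[ℝ] EH :=
  tangentAtOne J J (Φ.toHom g)

/-- The derivative `φ = Φ̃_{*e} : 𝔤 → L(𝔥, 𝔥)`. -/
def differentiated (Φ : LieGroupAction I J G H) :
    GroupLieAlgebra I G →L[ℝ] (EH →L[ℝ] EH) :=
  mfderiv I 𝓘(ℝ, EH →L[ℝ] EH) Φ.tangentAut 1

end LieGroupAction

/-- A smooth map `𝓑 : H → G` that is a relative Rota-Baxter operator with respect to the action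
`Φ : G → Aut(H)`. -/
structure RelRotaBaxterGroup (Φ : LieGroupAction I J G H) where
  /-- the operator -/
  op : H → G
  contMDiff_op : ContMDiff J I ∞ op
  op_mul_op : ∀ h₁ h₂ : H, op h₁ * op h₂ = op (h₁ * Φ.toHom (op h₁) h₂)

namespace RelRotaBaxterGroup

variable {Φ : LieGroupAction I J G H}

theorem op_one (𝓑 : RelRotaBaxterGroup Φ) : 𝓑.op 1 = 1 := by
  have h := 𝓑.op_mul_op 1 1
  rw [map_one, one_mul] at h
  exact mul_eq_left.mp h

/-- Homomorphisms of relative Rota-Baxter operators on Lie groups: pairs of Lie group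
homomorphisms `Ψ_G : G → G` and `Ψ_H : H → H` compatible with the operators and with the action. -/
@[ext]
structure Hom (𝓑' 𝓑 : RelRotaBaxterGroup Φ) where
  /-- the component `Ψ_G` -/
  onTarget : G →* G
  /-- the component `Ψ_H` -/
  onSource : H →* H
  contMDiff_onTarget : ContMDiff I I ∞ onTarget
  contMDiff_onSource : ContMDiff J J ∞ onSource
  op_onSource : ∀ h, 𝓑.op (onSource h) = onTarget (𝓑'.op h)
  onSource_act : ∀ g h, onSource (Φ.toHom g h) = Φ.toHom (onTarget g) (onSource h)

/-- The category of relative Rota-Baxter operators on `G` with respect to `(H; Φ)`. -/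
instance : Category (RelRotaBaxterGroup Φ) where
  Hom := Hom
  id 𝓑 := ⟨MonoidHom.id G, MonoidHom.id H, contMDiff_id, contMDiff_id, fun _ => rfl, fun _ _ => rfl⟩
  comp f g :=
    { onTarget := g.onTarget.comp f.onTarget
      onSource := g.onSource.comp f.onSource
      contMDiff_onTarget := g.contMDiff_onTarget.comp f.contMDiff_onTarget
      contMDiff_onSource := g.contMDiff_onSource.comp f.contMDiff_onSource
      op_onSource := fun h => by
        rw [MonoidHom.comp_apply, MonoidHom.comp_apply, g.op_onSource, f.op_onSource]
      onSource_act := fun x h => by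
        rw [MonoidHom.comp_apply, MonoidHom.comp_apply, MonoidHom.comp_apply, f.onSource_act,
          g.onSource_act] }

/-- The tangent map `B = 𝓑_{*e} : 𝔥 → 𝔤` (recall `𝓑 1 = 1`, see `op_one`). -/
def tangent (𝓑 : RelRotaBaxterGroup Φ) : GroupLieAlgebra J H →L[ℝ] GroupLieAlgebra I G :=
  tangentAtOne J I 𝓑.op

end RelRotaBaxterGroup

end LieGroups

end

/-!
The proof reads everything in the preferred charts around the identities and reduces each claim to
one comparison of mixed second derivatives.

For a product `N` near a point `p` which is a two-sided unit, let `β(u, v) = ∂_x ∂_y N (u, v)` at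
`(p, p)` (`mixedFDeriv`). If `N` is the multiplication of a Lie group in the chart, then the
left-invariant field of `v` is `x ↦ ∂_y N(x, p) v`, so the Lie bracket is `β(u, v) - β(v, u)`
(`GroupLieAlgebra.bracket_eq_mixedFDeriv`). If `f (N (x, y)) = K (f x, f y)`, then taking the mixed
derivative gives `f''(u, v) + f' (β(u, v)) = ∂_x ∂_y K (f' u, f' v)`. As `f''` is symmetric, it
disappears on antisymmetrizing (`fderiv_mixedFDeriv_sub_of_intertwines`). This is used three times.

* For a group homomorphism `f` it says that the tangent map preserves brackets
  (`tangentAtOne_lie`).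
* For `f = Φ̃ : g ↦ Φ(g)_{*e}` and `K` the composition of operators it says that `φ = Φ̃_{*e}` takes
  brackets to commutators. The values of `φ` are derivations because every `Φ(g)_{*e}` preserves the
  bracket of `𝔥`, an identity which is differentiated at `g = 1` (`differentiatedEnd_lie`).
* A relative Rota-Baxter operator `𝓑` is multiplicative for the descendent product
  `h * Φ(𝓑 h) k` on `H`. Its mixed derivative is that of the multiplication of `H` plus that of
  `Φ(𝓑 h) k`, and the latter is `φ(B u) v` because `φ` is the mixed derivative of the action
  (`mixedFDeriv_descendent`). Antisymmetrizing gives the weight `1` identity.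

The functor is then the chain rule at the identity, together with the derivative at `g = 1` of the
equivariance `Ψ_{H*} ∘ Φ̃(g) = Φ̃(Ψ_G g) ∘ Ψ_{H*}` for the compatibility with `φ`.
-/

/-! ### Mixed second derivatives -/

section Calculus

open scoped Topology

variable {E E' F F' P : Type*} [NormedAddCommGroup E] [NormedSpace ℝ E]
  [NormedAddCommGroup E'] [NormedSpace ℝ E'] [NormedAddCommGroup F] [NormedSpace ℝ F]
  [NormedAddCommGroup F'] [NormedSpace ℝ F'] [NormedAddCommGroup P] [NormedSpace ℝ P]

/-- The mixed second derivative `∂_x ∂_y K` of a map `K` of two variables at `z`, as a bilinear map: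
the full second derivative evaluated at the vectors `(u, 0)` and `(0, v)`. -/
noncomputable def mixedFDeriv (K : E × F → P) (z : E × F) : E →L[ℝ] F →L[ℝ] P :=
  ((ContinuousLinearMap.compL ℝ F (E × F) P).flip (ContinuousLinearMap.inr ℝ E F)).comp
    ((fderiv ℝ (fderiv ℝ K) z).comp (ContinuousLinearMap.inl ℝ E F))

theorem mixedFDeriv_apply (K : E × F → P) (z : E × F) (u : E) (v : F) :
    mixedFDeriv K z u v = fderiv ℝ (fderiv ℝ K) z (u, 0) (0, v) := by
  simp [mixedFDeriv]

theorem Filter.EventuallyEq.mixedFDeriv_eq {K K' : E × F → P} {z : E × F} (h : K =ᶠ[𝓝 z] K') :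
    mixedFDeriv K z = mixedFDeriv K' z := by
  rw [mixedFDeriv, h.fderiv.fderiv_eq, mixedFDeriv]

theorem ContDiffAt.differentiableAt_fderiv {f : E → F} {x : E} (hf : ContDiffAt ℝ 2 f x) :
    DifferentiableAt ℝ (fderiv ℝ f) x :=
  (hf.fderiv_right (m := 1) (by norm_num)).differentiableAt (by norm_num)

/-- The chain rule for second derivatives. -/
theorem fderiv_fderiv_comp {f : F → P} {g : E → F} {x : E} (hf : ContDiffAt ℝ 2 f (g x))
    (hg : ContDiffAt ℝ 2 g x) (a b : E) :
    fderiv ℝ (fderiv ℝ fun y => f (g y)) x a b =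
      fderiv ℝ (fderiv ℝ f) (g x) (fderiv ℝ g x a) (fderiv ℝ g x b) +
        fderiv ℝ f (g x) (fderiv ℝ (fderiv ℝ g) x a b) := by
  have hev : fderiv ℝ (fun y => f (g y)) =ᶠ[𝓝 x]
      fun y => (fderiv ℝ f (g y)).comp (fderiv ℝ g y) := by
    filter_upwards [hg.continuousAt.eventually (hf.eventually (by simp)),
      hg.eventually (by simp)] with y h1 h2
    exact fderiv_comp y (h1.differentiableAt (by norm_num)) (h2.differentiableAt (by norm_num))
  have h1 : HasFDerivAt (fun y => fderiv ℝ f (g y))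
      ((fderiv ℝ (fderiv ℝ f) (g x)).comp (fderiv ℝ g x)) x :=
    hf.differentiableAt_fderiv.hasFDerivAt.comp x
      (hg.differentiableAt (by norm_num)).hasFDerivAt
  rw [hev.fderiv_eq, (h1.clm_comp hg.differentiableAt_fderiv.hasFDerivAt).fderiv]
  simp [add_comm]

/-- The mixed derivative of `K` is the derivative in the first variable of the partial derivative
in the second variable. -/
theorem ContDiffAt.hasFDerivAt_fderiv_mk {K : E × F → P} {p : E} {q : F}
    (hK : ContDiffAt ℝ 2 K (p, q)) :
    HasFDerivAt (fun x => fderiv ℝ (fun y => K (x, y)) q) (mixedFDeriv K (p, q)) p := by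
  have hev : (fun x => fderiv ℝ (fun y => K (x, y)) q) =ᶠ[𝓝 p]
      fun x => (fderiv ℝ K (x, q)).comp (ContinuousLinearMap.inr ℝ E F) := by
    have hc : ContinuousAt (fun x : E => (x, q)) p := by fun_prop
    filter_upwards [hc.eventually (hK.eventually (by simp))] with x hx
    exact ((hx.differentiableAt (by norm_num)).hasFDerivAt.comp q
      (hasFDerivAt_prodMk_right x q)).fderiv
  have h1 : HasFDerivAt (fun x => fderiv ℝ K (x, q))
      ((fderiv ℝ (fderiv ℝ K) (p, q)).comp (ContinuousLinearMap.inl ℝ E F)) p :=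
    hK.differentiableAt_fderiv.hasFDerivAt.comp p (hasFDerivAt_prodMk_left p q)
  exact HasFDerivAt.congr_of_eventuallyEq (ContinuousLinearMap.hasFDerivAt _ |>.comp p h1) hev

/-- When each variable is precomposed with a map of its own, only the first derivatives of these
maps enter the mixed derivative. -/
theorem mixedFDeriv_comp_prodMap {K : E' × F' → P} {f : E → E'} {g : F → F'} {p : E} {q : F}
    (hK : ContDiffAt ℝ 2 K (f p, g q)) (hf : ContDiffAt ℝ 2 f p) (hg : ContDiffAt ℝ 2 g q)
    (u : E) (v : F) :
    mixedFDeriv (fun z : E × F => K (f z.1, g z.2)) (p, q) u v =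
      mixedFDeriv K (f p, g q) (fderiv ℝ f p u) (fderiv ℝ g q v) := by
  have hK' : ContDiffAt ℝ 2 (fun z : E × F => K (f z.1, g z.2)) (p, q) := by
    refine ContDiffAt.comp (p, q) (g := K) (f := fun z : E × F => (f z.1, g z.2)) hK ?_
    exact (hf.comp (p, q) contDiffAt_fst).prodMk (hg.comp (p, q) contDiffAt_snd)
  rw [← hK'.hasFDerivAt_fderiv_mk.fderiv]
  have hev : (fun x => fderiv ℝ (fun y => K (f x, g y)) q) =ᶠ[𝓝 p]
      fun x => ((fderiv ℝ K (f x, g q)).comp (ContinuousLinearMap.inr ℝ E' F')).comp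
        (fderiv ℝ g q) := by
    have hc : ContinuousAt (fun x : E => (f x, g q)) p :=
      hf.continuousAt.prodMk continuousAt_const
    filter_upwards [hc.eventually (hK.eventually (by simp))] with x hx
    exact (((hx.differentiableAt (by norm_num)).hasFDerivAt.comp (g q)
      (hasFDerivAt_prodMk_right (f x) (g q))).comp q
        (hg.differentiableAt (by norm_num)).hasFDerivAt).fderiv
  have h1 : HasFDerivAt (fun x => fderiv ℝ K (f x, g q))
      ((fderiv ℝ (fderiv ℝ K) (f p, g q)).comp
        ((ContinuousLinearMap.inl ℝ E' F').comp (fderiv ℝ f p))) p :=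
    hK.differentiableAt_fderiv.hasFDerivAt.comp p
      ((hasFDerivAt_prodMk_left (f p) (g q)).comp p
        (hf.differentiableAt (by norm_num)).hasFDerivAt)
  rw [hev.fderiv_eq,
    ((h1.clm_comp (hasFDerivAt_const _ _)).clm_comp (hasFDerivAt_const _ _)).fderiv]
  simp [mixedFDeriv_apply]

/-- If `N (x, q) = g x` near `p`, the derivative of `N` in the first variable is that of `g`. -/
theorem fderiv_apply_inl_of_eventuallyEq {N : E × F → P} {g : E → P} {p : E} {q : F}
    (hN : DifferentiableAt ℝ N (p, q)) (h : ∀ᶠ x in 𝓝 p, N (x, q) = g x) (u : E) :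
    fderiv ℝ N (p, q) (u, 0) = fderiv ℝ g p u := by
  have h1 : HasFDerivAt (fun x => N (x, q))
      ((fderiv ℝ N (p, q)).comp (ContinuousLinearMap.inl ℝ E F)) p :=
    hN.hasFDerivAt.comp p (hasFDerivAt_prodMk_left p q)
  have h2 : (fun x => N (x, q)) =ᶠ[𝓝 p] g := h
  rw [← h2.fderiv_eq, h1.fderiv]
  simp

theorem fderiv_apply_inr_of_eventuallyEq {N : E × F → P} {g : F → P} {p : E} {q : F}
    (hN : DifferentiableAt ℝ N (p, q)) (h : ∀ᶠ y in 𝓝 q, N (p, y) = g y) (v : F) :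
    fderiv ℝ N (p, q) (0, v) = fderiv ℝ g q v := by
  have h1 : HasFDerivAt (fun y => N (p, y))
      ((fderiv ℝ N (p, q)).comp (ContinuousLinearMap.inr ℝ E F)) q :=
    hN.hasFDerivAt.comp q (hasFDerivAt_prodMk_right p q)
  have h2 : (fun y => N (p, y)) =ᶠ[𝓝 q] g := h
  rw [← h2.fderiv_eq, h1.fderiv]
  simp

/-- If `f` intertwines a product `N` with unit `p` and a map `K`, then its derivative at the unit
intertwines the antisymmetrized mixed derivatives: the mixed derivatives themselves correspond up to
the second derivative of `f`, which is symmetric. -/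
theorem fderiv_mixedFDeriv_sub_of_intertwines {N : E × E → E} {K : F × F → F} {f : E → F} {p : E}
    (hN : ContDiffAt ℝ 2 N (p, p)) (hK : ContDiffAt ℝ 2 K (f p, f p)) (hf : ContDiffAt ℝ 2 f p)
    (hl : ∀ᶠ x in 𝓝 p, N (x, p) = x) (hr : ∀ᶠ y in 𝓝 p, N (p, y) = y)
    (h : ∀ᶠ z in 𝓝 (p, p), f (N z) = K (f z.1, f z.2)) (u v : E) :
    fderiv ℝ f p (mixedFDeriv N (p, p) u v - mixedFDeriv N (p, p) v u) =
      mixedFDeriv K (f p, f p) (fderiv ℝ f p u) (fderiv ℝ f p v) -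
        mixedFDeriv K (f p, f p) (fderiv ℝ f p v) (fderiv ℝ f p u) := by
  have hp : N (p, p) = p := hl.self_of_nhds
  -- Take the mixed derivative of both sides of `f (N (x, y)) = K (f x, f y)`.
  have key : ∀ u v : E, fderiv ℝ (fderiv ℝ f) p u v + fderiv ℝ f p (mixedFDeriv N (p, p) u v) =
      mixedFDeriv K (f p, f p) (fderiv ℝ f p u) (fderiv ℝ f p v) := by
    intro u v
    rw [← mixedFDeriv_comp_prodMap hK hf hf]
    have h' : (fun z => f (N z)) =ᶠ[𝓝 (p, p)] fun z => K (f z.1, f z.2) := h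
    have hd : DifferentiableAt ℝ N (p, p) := hN.differentiableAt (by norm_num)
    rw [mixedFDeriv_apply, mixedFDeriv_apply, ← h'.fderiv.fderiv_eq,
      fderiv_fderiv_comp (by rwa [hp]) hN, hp,
      fderiv_apply_inl_of_eventuallyEq hd (g := id) hl,
      fderiv_apply_inr_of_eventuallyEq hd (g := id) hr]
    simp
  have hs : fderiv ℝ (fderiv ℝ f) p u v = fderiv ℝ (fderiv ℝ f) p v u :=
    hf.isSymmSndFDerivAt (by simp) u v
  rw [map_sub, ← key u v, ← key v u, hs]
  abel

/-- Let `α` satisfy `α (x, q) = q` and `α (q, y) = y`, like a family of automorphisms starting at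
the identity, and let `q` be a left unit of `m`. Then the mixed derivative of the twisted product
`m (x, α (x, y))` is the sum of those of `m` and `α`. -/
theorem mixedFDeriv_mul_act {m α : E × E → E} {q : E} (hm : ContDiffAt ℝ 2 m (q, q))
    (hα : ContDiffAt ℝ 2 α (q, q)) (hmr : ∀ᶠ y in 𝓝 q, m (q, y) = y)
    (hαl : ∀ᶠ x in 𝓝 q, α (x, q) = q) (hαr : ∀ᶠ y in 𝓝 q, α (q, y) = y) :
    mixedFDeriv (fun z => m (z.1, α z)) (q, q) =
      mixedFDeriv m (q, q) + mixedFDeriv α (q, q) := by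
  have hq : α (q, q) = q := hαl.self_of_nhds
  have hk : ContDiffAt ℝ 2 (fun z : E × E => (z.1, α z)) (q, q) := contDiffAt_fst.prodMk hα
  have hαd : DifferentiableAt ℝ α (q, q) := hα.differentiableAt (by norm_num)
  have hk' : fderiv ℝ (fun z : E × E => (z.1, α z)) =ᶠ[𝓝 (q, q)]
      fun z => (ContinuousLinearMap.inl ℝ E E).comp (ContinuousLinearMap.fst ℝ E E) +
        (ContinuousLinearMap.inr ℝ E E).comp (fderiv ℝ α z) := by
    filter_upwards [hα.eventually (by simp)] with z hz
    rw [(hasFDerivAt_fst.prodMk (hz.differentiableAt (by norm_num)).hasFDerivAt).fderiv]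
    ext <;> simp
  have hk'' : ∀ a b : E × E, fderiv ℝ (fderiv ℝ fun z : E × E => (z.1, α z)) (q, q) a b =
      (0, fderiv ℝ (fderiv ℝ α) (q, q) a b) := by
    intro a b
    have h := (((ContinuousLinearMap.compL ℝ (E × E) E (E × E)
      (ContinuousLinearMap.inr ℝ E E)).hasFDerivAt.comp (q, q)
        hα.differentiableAt_fderiv.hasFDerivAt).const_add
          ((ContinuousLinearMap.inl ℝ E E).comp (ContinuousLinearMap.fst ℝ E E))).fderiv
    rw [hk'.fderiv_eq]
    exact (congrArg (fun T : E × E →L[ℝ] E × E →L[ℝ] E × E => T a b) h).trans (by simp)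
  ext u v
  rw [mixedFDeriv_apply, fderiv_fderiv_comp (f := m) (by rwa [hq]) hk, hk'']
  simp only [hk'.self_of_nhds, hq, _root_.add_apply, ContinuousLinearMap.comp_apply,
    ContinuousLinearMap.coe_fst', ContinuousLinearMap.inl_apply, ContinuousLinearMap.inr_apply,
    Prod.mk_add_mk, add_zero, zero_add,
    fderiv_apply_inl_of_eventuallyEq hαd hαl, fderiv_apply_inr_of_eventuallyEq hαd (g := id) hαr,
    fderiv_apply_inr_of_eventuallyEq (hm.differentiableAt (by norm_num)) (g := id) hmr,
    ← mixedFDeriv_apply]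
  simp [mixedFDeriv_apply]

/-- A smooth family of automorphisms of a bilinear product, starting at the identity, differentiates
to derivations. -/
theorem fderiv_apply_of_automorphisms {A : E → F →L[ℝ] F} {p : E} {b : F →L[ℝ] F →L[ℝ] F}
    (hA : DifferentiableAt ℝ A p) (hp : A p = ContinuousLinearMap.id ℝ F)
    (h : ∀ x u v, A x (b u v) = b (A x u) (A x v)) (w : E) (u v : F) :
    fderiv ℝ A p w (b u v) = b (fderiv ℝ A p w u) v + b u (fderiv ℝ A p w v) := by
  have h1 : ∀ u : F, HasFDerivAt (fun x => A x u) ((fderiv ℝ A p).flip u) p := fun u => by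
    simpa using! hA.hasFDerivAt.clm_apply (hasFDerivAt_const u p)
  have h2 := ((b.hasFDerivAt (x := A p u)).comp p (h1 u)).clm_apply (h1 v)
  have h3 := h1 (b u v)
  simp only [h] at h3
  have h4 := congrArg (fun T : E →L[ℝ] F => T w) (h3.unique h2)
  simpa [hp, add_comm] using! h4

/-- The product of bounded operators is bilinear, hence its own mixed derivative. -/
theorem mixedFDeriv_clm_comp (z : (F →L[ℝ] F) × (F →L[ℝ] F)) (S T : F →L[ℝ] F) :
    mixedFDeriv (fun z : (F →L[ℝ] F) × (F →L[ℝ] F) => z.1.comp z.2) z S T = S.comp T := by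
  have hK : ContDiffAt ℝ 2 (fun z : (F →L[ℝ] F) × (F →L[ℝ] F) => z.1.comp z.2) (z.1, z.2) :=
    contDiffAt_fst.clm_comp contDiffAt_snd
  have h1 : (fun x : F →L[ℝ] F => fderiv ℝ (fun y : F →L[ℝ] F => x.comp y) z.2) =
      ContinuousLinearMap.compL ℝ F F F := by
    ext1 x
    exact (ContinuousLinearMap.compL ℝ F F F x).fderiv
  have h2 := hK.hasFDerivAt_fderiv_mk.fderiv
  simp only [h1, ContinuousLinearMap.fderiv] at h2
  rw [← Prod.mk.eta (p := z), ← h2]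
  rfl

end Calculus

/-! ### Lie groups in the chart around the identity -/

section Charts

open scoped Topology

variable {EG : Type*} [NormedAddCommGroup EG] [NormedSpace ℝ EG]
  {MG : Type*} [TopologicalSpace MG] {I : ModelWithCorners ℝ EG MG}
  {EH : Type*} [NormedAddCommGroup EH] [NormedSpace ℝ EH]
  {MH : Type*} [TopologicalSpace MH] {J : ModelWithCorners ℝ EH MH}
  {EK : Type*} [NormedAddCommGroup EK] [NormedSpace ℝ EK]
  {MK : Type*} [TopologicalSpace MK] {L : ModelWithCorners ℝ EK MK}
  {G : Type*} [TopologicalSpace G] [ChartedSpace MG G] [Group G]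
  {H : Type*} [TopologicalSpace H] [ChartedSpace MH H] [Group H]
  {K : Type*} [TopologicalSpace K] [ChartedSpace MK K] [Group K]

variable (I G) in
/-- The coordinate of the identity in the preferred chart around it. -/
noncomputable def oneCoord : EG := extChartAt I (1 : G) 1

variable (I J) in
/-- A map `f : G → H` read in the preferred charts around the identities. Only its germ at
`oneCoord I G` is meaningful; away from the chart domains its values are junk. -/
noncomputable def chartMap (f : G → H) (x : EG) : EH :=
  extChartAt J (1 : H) (f ((extChartAt I (1 : G)).symm x))

variable (I J L) in
/-- A map `f : G → H → K` of two variables read in the preferred charts around the identities. As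
for `chartMap`, only its germ at the pair of identity coordinates is meaningful. -/
noncomputable def chartMap₂ (f : G → H → K) (z : EG × EH) : EK :=
  extChartAt L (1 : K) (f ((extChartAt I (1 : G)).symm z.1) ((extChartAt J (1 : H)).symm z.2))

theorem extChartAt_symm_oneCoord : (extChartAt I (1 : G)).symm (oneCoord I G) = 1 :=
  extChartAt_to_inv 1

theorem tendsto_extChartAt_symm_oneCoord :
    Filter.Tendsto (extChartAt I (1 : G)).symm (𝓝 (oneCoord I G)) (𝓝 1) := by
  have h := continuousAt_extChartAt_symm (I := I) (1 : G)
  rwa [ContinuousAt, extChartAt_to_inv] at h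

theorem tendsto_extChartAt_symm_prod_oneCoord :
    Filter.Tendsto (fun z : EG × EH =>
        ((extChartAt I (1 : G)).symm z.1, (extChartAt J (1 : H)).symm z.2))
      (𝓝 (oneCoord I G, oneCoord J H)) (𝓝 ((1 : G), (1 : H))) := by
  rw [nhds_prod_eq, nhds_prod_eq]
  exact tendsto_extChartAt_symm_oneCoord.prodMap tendsto_extChartAt_symm_oneCoord

theorem contMDiffAt_extChartAt_one [IsManifold I ∞ G] {g : G} (hg : g = 1) :
    ContMDiffAt I 𝓘(ℝ, EG) ∞ (extChartAt I (1 : G)) g := by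
  subst hg; exact contMDiffAt_extChartAt

theorem chartMap_oneCoord {f : G → H} (hf : f 1 = 1) :
    chartMap I J f (oneCoord I G) = oneCoord J H := by
  rw [chartMap, extChartAt_symm_oneCoord, hf, oneCoord]

theorem eventually_extChartAt_symm_extChartAt {X : Type*} [TopologicalSpace X] {x₀ : X}
    {f : X → G} (hf : Filter.Tendsto f (𝓝 x₀) (𝓝 1)) :
    ∀ᶠ x in 𝓝 x₀, (extChartAt I (1 : G)).symm (extChartAt I (1 : G) (f x)) = f x := by
  filter_upwards [hf.eventually (extChartAt_source_mem_nhds (I := I) (1 : G))] with x hx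
  exact (extChartAt I (1 : G)).left_inv hx

theorem eventually_extChartAt_extChartAt_symm [I.Boundaryless] :
    ∀ᶠ x in 𝓝 (oneCoord I G), extChartAt I (1 : G) ((extChartAt I (1 : G)).symm x) = x := by
  filter_upwards [extChartAt_target_mem_nhds (I := I) (1 : G)] with x hx
  exact (extChartAt I (1 : G)).right_inv hx

theorem contMDiffAt_extChartAt_symm_oneCoord [I.Boundaryless] [IsManifold I ∞ G] :
    ContMDiffAt 𝓘(ℝ, EG) I ∞ (extChartAt I (1 : G)).symm (oneCoord I G) :=
  (contMDiffOn_extChartAt_symm 1).contMDiffAt (extChartAt_target_mem_nhds 1)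

theorem contDiffAt_chartMap [I.Boundaryless] [IsManifold I ∞ G] [IsManifold J ∞ H]
    {f : G → H} (hf : f 1 = 1) (hs : ContMDiffAt I J ∞ f 1) :
    ContDiffAt ℝ ∞ (chartMap I J f) (oneCoord I G) := by
  rw [← contMDiffAt_iff_contDiffAt]
  refine (contMDiffAt_extChartAt_one ?_).comp _
    (ContMDiffAt.comp (oneCoord I G) ?_ contMDiffAt_extChartAt_symm_oneCoord)
  · rw [extChartAt_symm_oneCoord, hf]
  · rwa [extChartAt_symm_oneCoord]

theorem contDiffAt_chartMap₂ [I.Boundaryless] [J.Boundaryless] [IsManifold I ∞ G]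
    [IsManifold J ∞ H] [IsManifold L ∞ K]
    {f : G → H → K} (hf : f 1 1 = 1)
    (hs : ContMDiffAt (I.prod J) L ∞ (fun z : G × H => f z.1 z.2) (1, 1)) :
    ContDiffAt ℝ ∞ (chartMap₂ I J L f) (oneCoord I G, oneCoord J H) := by
  rw [← contMDiffAt_iff_contDiffAt]
  have h1 : ContMDiffAt 𝓘(ℝ, EG × EH) (I.prod J) ∞
      (fun z : EG × EH => ((extChartAt I (1 : G)).symm z.1, (extChartAt J (1 : H)).symm z.2))
      (oneCoord I G, oneCoord J H) :=
    (contMDiffAt_extChartAt_symm_oneCoord.comp (oneCoord I G, oneCoord J H)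
      contDiffAt_fst.contMDiffAt).prodMk
      (contMDiffAt_extChartAt_symm_oneCoord.comp (oneCoord I G, oneCoord J H)
        contDiffAt_snd.contMDiffAt)
  refine (contMDiffAt_extChartAt_one ?_).comp _
    (ContMDiffAt.comp (g := fun z : G × H => f z.1 z.2) (oneCoord I G, oneCoord J H) ?_ h1)
  · simp only [extChartAt_symm_oneCoord, hf]
  · simpa only [extChartAt_symm_oneCoord] using hs

theorem mfderiv_one_eq_fderiv [I.Boundaryless] {f : G → EK}
    (hf : MDifferentiableAt I 𝓘(ℝ, EK) f 1) :
    (mfderiv I 𝓘(ℝ, EK) f 1 : EG →L[ℝ] EK) =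
      fderiv ℝ (fun x => f ((extChartAt I (1 : G)).symm x)) (oneCoord I G) := by
  refine hf.mfderiv.trans ?_
  rw [I.range_eq_univ, fderivWithin_univ]
  rfl

theorem tangentAtOne_eq_fderiv [I.Boundaryless] {f : G → H} (hf : f 1 = 1)
    (hs : MDifferentiableAt I J f 1) :
    (tangentAtOne I J f : EG →L[ℝ] EH) = fderiv ℝ (chartMap I J f) (oneCoord I G) := by
  have h : writtenInExtChartAt I J 1 f = chartMap I J f := by
    ext x
    simp only [writtenInExtChartAt, hf, chartMap, Function.comp_apply]
  refine hs.mfderiv.trans ?_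
  rw [I.range_eq_univ, fderivWithin_univ, h]
  rfl

section Bracket

variable [I.Boundaryless]

variable (I G) in
/-- The multiplication of `G` read in the preferred chart around the identity. -/
noncomputable def chartMul : EG × EG → EG := chartMap₂ I I I fun g h : G => g * h

theorem eventually_chartMul_oneCoord_right :
    ∀ᶠ x in 𝓝 (oneCoord I G), chartMul I G (x, oneCoord I G) = x := by
  filter_upwards [eventually_extChartAt_extChartAt_symm (I := I) (G := G)] with x hx
  rw [chartMul, chartMap₂, extChartAt_symm_oneCoord, mul_one, hx]

theorem eventually_chartMul_oneCoord_left :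
    ∀ᶠ x in 𝓝 (oneCoord I G), chartMul I G (oneCoord I G, x) = x := by
  filter_upwards [eventually_extChartAt_extChartAt_symm (I := I) (G := G)] with x hx
  rw [chartMul, chartMap₂, extChartAt_symm_oneCoord, one_mul, hx]

variable [LieGroup I ∞ G]

theorem contDiffAt_chartMul :
    ContDiffAt ℝ ∞ (chartMul I G) (oneCoord I G, oneCoord I G) :=
  contDiffAt_chartMap₂ (mul_one 1) (contMDiff_mul I ∞).contMDiffAt

/-- In the chart, the left-invariant vector field of `v` is the partial derivative of the
multiplication in the second variable. -/
theorem eventually_mpullbackWithin_mulInvariantVectorField (v : GroupLieAlgebra I G) :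
    ∀ᶠ x in 𝓝 (oneCoord I G),
      (VectorField.mpullbackWithin 𝓘(ℝ, EG) I (extChartAt I (1 : G)).symm
        (mulInvariantVectorField v) Set.univ x : EG) =
      fderiv ℝ (fun y => chartMul I G (x, y)) (oneCoord I G) v := by
  filter_upwards [extChartAt_target_mem_nhds (I := I) (1 : G)] with x hx
  -- The inverse of the derivative of the inverse chart is the derivative of the chart.
  have hI := mfderiv_extChartAt_comp_mfderivWithin_extChartAt_symm (I := I) hx
  have hI' := mfderivWithin_extChartAt_symm_comp_mfderiv_extChartAt (I := I) hx
  rw [I.range_eq_univ] at hI hI'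
  rw [VectorField.mpullbackWithin_apply, ContinuousLinearMap.inverse_eq hI' hI]
  set g : G := (extChartAt I (1 : G)).symm x with hg
  have hc : MDifferentiableAt I 𝓘(ℝ, EG) (extChartAt I (1 : G)) g :=
    mdifferentiableAt_extChartAt
      (by simpa only [extChartAt_source] using (extChartAt I (1 : G)).map_target hx)
  have hm : MDifferentiableAt I I (fun h : G => g * h) 1 :=
    (contMDiff_mul_left (I := I) (n := ∞) (a := g)).contMDiffAt.mdifferentiableAt (by simp)
  have hcm : MDifferentiableAt I 𝓘(ℝ, EG) (fun h : G => extChartAt I (1 : G) (g * h)) 1 :=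
    MDifferentiableAt.comp_of_eq (g := extChartAt I (1 : G)) 1 hc hm (mul_one g)
  refine Eq.trans ?_ (congrArg (fun A : EG →L[ℝ] EG => A v) (mfderiv_one_eq_fderiv hcm))
  have := mfderiv_comp_of_eq (x := 1) (y := g) hc hm (mul_one g)
  refine Eq.trans ?_ (congrArg (fun A : EG →L[ℝ] EG => A v) this).symm
  -- The chain rule differentiates the chart at `g * 1` instead of `g`.
  exact congrArg (fun h : G => (mfderiv I 𝓘(ℝ, EG) (extChartAt I (1 : G)) h : EG →L[ℝ] EG)
    (mulInvariantVectorField v g : EG)) (mul_one g).symm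

/-- The Lie bracket is the antisymmetrized mixed derivative of the multiplication in the chart. -/
theorem GroupLieAlgebra.bracket_eq_mixedFDeriv (u v : GroupLieAlgebra I G) :
    (⁅u, v⁆ : GroupLieAlgebra I G) =
      (mixedFDeriv (chartMul I G) (oneCoord I G, oneCoord I G) u v -
        mixedFDeriv (chartMul I G) (oneCoord I G, oneCoord I G) v u : EG) := by
  have hval : ∀ w : EG,
      fderiv ℝ (fun y => chartMul I G (oneCoord I G, y)) (oneCoord I G) w = w := by
    intro w
    have h : (fun y => chartMul I G (oneCoord I G, y)) =ᶠ[𝓝 (oneCoord I G)] id :=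
      eventually_chartMul_oneCoord_left
    rw [h.fderiv_eq]
    simp
  have hmix : ∀ u v : EG, fderiv ℝ (fun x => fderiv ℝ (fun y => chartMul I G (x, y))
      (oneCoord I G) v) (oneCoord I G) u =
        mixedFDeriv (chartMul I G) (oneCoord I G, oneCoord I G) u v := by
    intro u v
    have hC : ContDiffAt ℝ 2 (chartMul I G) (oneCoord I G, oneCoord I G) :=
      contDiffAt_chartMul.of_le ENat.LEInfty.out
    rw [fderiv_clm_apply hC.hasFDerivAt_fderiv_mk.differentiableAt (differentiableAt_const _),
      hC.hasFDerivAt_fderiv_mk.fderiv]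
    simp
  -- `X w` is the left-invariant vector field of `w` in the chart.
  let X : EG → EG → EG := fun w => VectorField.mpullbackWithin 𝓘(ℝ, EG) I
    (extChartAt I (1 : G)).symm (mulInvariantVectorField (w : GroupLieAlgebra I G)) Set.univ
  let b : EG := VectorField.lieBracket ℝ (X u) (X v) (oneCoord I G)
  -- At the identity `X w` has the value `w`, so each term of `[X u, X v]` is a mixed derivative.
  have key : ∀ u v : EG, VectorField.lieBracket ℝ (X u) (X v) (oneCoord I G) =
      mixedFDeriv (chartMul I G) (oneCoord I G, oneCoord I G) u v -
        mixedFDeriv (chartMul I G) (oneCoord I G, oneCoord I G) v u := by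
    intro u v
    have hX : ∀ w, X w =ᶠ[𝓝 (oneCoord I G)]
        fun x => fderiv ℝ (fun y => chartMul I G (x, y)) (oneCoord I G) w :=
      eventually_mpullbackWithin_mulInvariantVectorField
    rw [(hX u).lieBracket_vectorField_eq (hX v), VectorField.lieBracket_eq]
    simp only [hval]
    rw [hmix, hmix]
  have hb : (⁅u, v⁆ : GroupLieAlgebra I G) =
      ((mfderiv I 𝓘(ℝ, EG) (extChartAt I (1 : G)) 1).inverse : EG →L[ℝ] EG) b := by
    rw [GroupLieAlgebra.bracket_def, ← VectorField.mlieBracketWithin_univ,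
      VectorField.mlieBracketWithin_apply, I.range_eq_univ, Set.preimage_univ, Set.univ_inter]
    have h : VectorField.lieBracketWithin ℝ (X u) (X v) Set.univ (oneCoord I G) =
        VectorField.lieBracket ℝ (X u) (X v) (oneCoord I G) := by
      rw [VectorField.lieBracketWithin_univ]
    exact congrArg (fun z : EG =>
      ((mfderiv I 𝓘(ℝ, EG) (extChartAt I (1 : G)) 1).inverse : EG →L[ℝ] EG) z) h
  -- The bracket of vector fields is pulled back along the chart, whose derivative at the base point
  -- is the identity.
  have hid : (mfderiv I 𝓘(ℝ, EG) (extChartAt I (1 : G)) 1).inverse =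
      ContinuousLinearMap.id ℝ EG := by
    rw [mfderiv_extChartAt_self]
    exact ContinuousLinearMap.inverse_id
  exact hb.trans ((congrArg (fun A : EG →L[ℝ] EG => A _) hid).trans (key u v))

end Bracket

end Charts

/-! ### Tangent maps at the identity -/

section LieFunctor

open scoped Topology

variable {EG : Type*} [NormedAddCommGroup EG] [NormedSpace ℝ EG]
  {MG : Type*} [TopologicalSpace MG] {I : ModelWithCorners ℝ EG MG}
  {EH : Type*} [NormedAddCommGroup EH] [NormedSpace ℝ EH]
  {MH : Type*} [TopologicalSpace MH] {J : ModelWithCorners ℝ EH MH}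
  {EK : Type*} [NormedAddCommGroup EK] [NormedSpace ℝ EK]
  {MK : Type*} [TopologicalSpace MK] {L : ModelWithCorners ℝ EK MK}
  {G : Type*} [TopologicalSpace G] [ChartedSpace MG G] [Group G]
  {H : Type*} [TopologicalSpace H] [ChartedSpace MH H] [Group H]
  {K : Type*} [TopologicalSpace K] [ChartedSpace MK K] [Group K]

theorem tangentAtOne_id : tangentAtOne I I (fun g : G => g) = ContinuousLinearMap.id ℝ EG :=
  mfderiv_id

theorem tangentAtOne_comp {f : G → H} {g : H → K} (hf : f 1 = 1)
    (hfs : MDifferentiableAt I J f 1) (hgs : MDifferentiableAt J L g 1) :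
    (tangentAtOne I L (fun x => g (f x)) : EG →L[ℝ] EK) =
      (tangentAtOne J L g : EH →L[ℝ] EK).comp (tangentAtOne I J f : EG →L[ℝ] EH) := by
  refine (mfderiv_comp_of_eq (x := 1) (y := 1) hgs hfs hf).trans ?_
  -- The derivative of `g` is at the base point `f 1`. Rewriting it to `1` makes sense because all
  -- tangent spaces are the model space.
  exact congrArg (fun h : H => let A : EH →L[ℝ] EK := mfderiv J L g h
    A.comp (tangentAtOne I J f : EG →L[ℝ] EH)) hf

variable [I.Boundaryless] [J.Boundaryless] [LieGroup I ∞ G] [LieGroup J ∞ H]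

/-- If `f` intertwines a smooth product `n` with unit `1` on the manifold `H` and the
multiplication of `G`, its tangent map takes the antisymmetrized mixed derivative of `n` to the
bracket of `G`. No associativity or inverses are needed for `n`. -/
theorem tangentAtOne_mixedFDeriv_sub {n : H → H → H} {f : H → G}
    (hns : ContMDiffAt (J.prod J) J ∞ (fun z : H × H => n z.1 z.2) (1, 1))
    (hnl : ∀ h, n h 1 = h) (hnr : ∀ h, n 1 h = h) (hf : f 1 = 1) (hfs : ContMDiffAt J I ∞ f 1)
    (h : ∀ h k, f (n h k) = f h * f k) (u v : EH) :
    (tangentAtOne J I f : EH →L[ℝ] EG)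
      (mixedFDeriv (chartMap₂ J J J n) (oneCoord J H, oneCoord J H) u v -
        mixedFDeriv (chartMap₂ J J J n) (oneCoord J H, oneCoord J H) v u) =
      (⁅(tangentAtOne J I f u : GroupLieAlgebra I G),
        (tangentAtOne J I f v : GroupLieAlgebra I G)⁆ :
        GroupLieAlgebra I G) := by
  have hN := contDiffAt_chartMap₂ (I := J) (J := J) (L := J) (hnl 1) hns
  have hF := contDiffAt_chartMap (I := J) (J := I) hf hfs
  have hp : chartMap J I f (oneCoord J H) = oneCoord I G := chartMap_oneCoord hf
  have hT := tangentAtOne_eq_fderiv (I := J) (J := I) hf (hfs.mdifferentiableAt (by simp))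
  have hM := contDiffAt_chartMul (I := I) (G := G)
  have htend := tendsto_extChartAt_symm_prod_oneCoord (I := J) (J := J) (G := H) (H := H)
  have hnt : Filter.Tendsto (fun z : H × H => n z.1 z.2) (𝓝 (1, 1)) (𝓝 1) := by
    simpa only [ContinuousAt, hnl] using hns.continuousAt
  have hft : Filter.Tendsto f (𝓝 1) (𝓝 1) := by
    simpa only [ContinuousAt, hf] using hfs.continuousAt
  have hint : ∀ᶠ z in 𝓝 (oneCoord J H, oneCoord J H), chartMap J I f (chartMap₂ J J J n z) =
      chartMul I G (chartMap J I f z.1, chartMap J I f z.2) := by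
    filter_upwards [eventually_extChartAt_symm_extChartAt (I := J) (hnt.comp htend),
      eventually_extChartAt_symm_extChartAt (I := I)
        (hft.comp ((continuous_fst.tendsto _).comp htend)),
      eventually_extChartAt_symm_extChartAt (I := I)
        (hft.comp ((continuous_snd.tendsto _).comp htend))] with z h1 h2 h3
    simp only [Function.comp_apply] at h1 h2 h3
    simp only [chartMul, chartMap, chartMap₂, h1, h2, h3, h]
  have hl : ∀ᶠ x in 𝓝 (oneCoord J H), chartMap₂ J J J n (x, oneCoord J H) = x := by
    filter_upwards [eventually_extChartAt_extChartAt_symm (I := J) (G := H)] with x hx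
    rw [chartMap₂, extChartAt_symm_oneCoord, hnl, hx]
  have hr : ∀ᶠ x in 𝓝 (oneCoord J H), chartMap₂ J J J n (oneCoord J H, x) = x := by
    filter_upwards [eventually_extChartAt_extChartAt_symm (I := J) (G := H)] with x hx
    rw [chartMap₂, extChartAt_symm_oneCoord, hnr, hx]
  have key := fderiv_mixedFDeriv_sub_of_intertwines (hN.of_le ENat.LEInfty.out)
    (by rw [hp]; exact hM.of_le ENat.LEInfty.out) (hF.of_le ENat.LEInfty.out) hl hr hint u v
  rw [hp, ← hT] at key
  exact key.trans (GroupLieAlgebra.bracket_eq_mixedFDeriv (I := I) (G := G) _ _).symm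

/-- The tangent map of a homomorphism of Lie groups is a homomorphism of Lie algebras. -/
theorem tangentAtOne_lie [CompleteSpace EG] [CompleteSpace EH] {f : H →* G}
    (hf : ContMDiff J I ∞ f) (u v : GroupLieAlgebra J H) :
    tangentAtOne J I f ⁅u, v⁆ =
      (⁅(tangentAtOne J I f u : GroupLieAlgebra I G),
        (tangentAtOne J I f v : GroupLieAlgebra I G)⁆ :
        GroupLieAlgebra I G) := by
  rw [GroupLieAlgebra.bracket_eq_mixedFDeriv u v]
  exact tangentAtOne_mixedFDeriv_sub (n := fun h k : H => h * k)
    (contMDiff_mul J ∞).contMDiffAt mul_one one_mul (map_one f) hf.contMDiffAt (map_mul f) u v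

/-- The Lie algebra homomorphism tangent to a homomorphism of Lie groups. -/
noncomputable def tangentLieHom [CompleteSpace EG] [CompleteSpace EH] (f : H →* G)
    (hf : ContMDiff J I ∞ f) : GroupLieAlgebra J H →ₗ⁅ℝ⁆ GroupLieAlgebra I G :=
  { (tangentAtOne J I f : GroupLieAlgebra J H →ₗ[ℝ] GroupLieAlgebra I G) with
    map_lie' := fun {u v} => tangentAtOne_lie hf u v }

end LieFunctor

/-! ### The differentiated action -/

section Action

open scoped Topology

variable {EG : Type*} [NormedAddCommGroup EG] [NormedSpace ℝ EG]
  {MG : Type*} [TopologicalSpace MG] {I : ModelWithCorners ℝ EG MG}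
  {EH : Type*} [NormedAddCommGroup EH] [NormedSpace ℝ EH]
  {MH : Type*} [TopologicalSpace MH] {J : ModelWithCorners ℝ EH MH}
  {G : Type*} [TopologicalSpace G] [ChartedSpace MG G] [Group G]
  {H : Type*} [TopologicalSpace H] [ChartedSpace MH H] [Group H]

namespace LieGroupAction

theorem contMDiff_act (Φ : LieGroupAction I J G H) (g : G) :
    ContMDiff J J ∞ (Φ.toHom g) :=
  Φ.contMDiff_toHom.comp (contMDiff_const.prodMk contMDiff_id)

theorem tangentAut_one (Φ : LieGroupAction I J G H) :
    Φ.tangentAut 1 = ContinuousLinearMap.id ℝ EH := by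
  rw [tangentAut, map_one]
  exact tangentAtOne_id

theorem tangentAut_mul (Φ : LieGroupAction I J G H) (g h : G) :
    Φ.tangentAut (g * h) = (Φ.tangentAut g).comp (Φ.tangentAut h) := by
  rw [tangentAut, map_mul]
  exact tangentAtOne_comp (map_one (Φ.toHom h))
    ((Φ.contMDiff_act h).contMDiffAt.mdifferentiableAt (by simp))
    ((Φ.contMDiff_act g).contMDiffAt.mdifferentiableAt (by simp))

/-- The map `g ↦ Φ(g)_{*e}` is smooth: in the tangent coordinates at the identity of `H`, which
every `Φ(g)` fixes, it is the partial derivative of the action map. -/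
theorem contMDiff_tangentAut [IsManifold I ∞ G] [IsManifold J ∞ H] (Φ : LieGroupAction I J G H) :
    ContMDiff I 𝓘(ℝ, EH →L[ℝ] EH) ∞ Φ.tangentAut := by
  have hm : IsManifold J 1 H := IsManifold.of_le (n := ∞) (by simp)
  intro g₀
  have h := ContMDiffAt.mfderiv (I := J) (I' := J) (m := ∞) (n := ∞) (x₀ := g₀)
    (fun g h => Φ.toHom g h) (fun _ : G => (1 : H)) Φ.contMDiff_toHom.contMDiffAt
    contMDiffAt_const (by simp)
  refine h.congr_of_eventuallyEq (Filter.Eventually.of_forall fun g => ?_)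
  have h1 : (fun g : G => Φ.toHom g 1) = fun _ => 1 := funext fun g => map_one (Φ.toHom g)
  have h2 : inTangentCoordinates J J (fun _ : G => (1 : H)) (fun _ : G => (1 : H))
      Φ.tangentAut g₀ g = Φ.tangentAut g := by
    rw [inTangentCoordinates_eq (x₀ := g₀) (x := g) (fun _ : G => (1 : H)) (fun _ : G => (1 : H))
      Φ.tangentAut (mem_chart_source MH (1 : H)) (mem_chart_source MH (1 : H))]
    ext v
    have hc : ∀ w : EH, (tangentBundleCore J H).coordChange (achart MH (1 : H))
        (achart MH (1 : H)) 1 w = w := fun w =>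
      (tangentBundleCore J H).coordChange_self (achart MH (1 : H)) 1 (mem_chart_source MH 1) w
    exact (hc _).trans (congrArg (Φ.tangentAut g) (hc v))
  exact h2.symm.trans (congrArg (fun γ : G → H =>
    inTangentCoordinates J J (fun _ => (1 : H)) γ Φ.tangentAut g₀ g) h1).symm

theorem mdifferentiableAt_tangentAut [IsManifold I ∞ G] [IsManifold J ∞ H]
    (Φ : LieGroupAction I J G H) (g : G) :
    MDifferentiableAt I 𝓘(ℝ, EH →L[ℝ] EH) Φ.tangentAut g :=
  Φ.contMDiff_tangentAut.contMDiffAt.mdifferentiableAt (by simp)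

/-- The map `g ↦ Φ(g)_{*e}` read in the preferred chart around the identity. -/
noncomputable def chartTangentAut (Φ : LieGroupAction I J G H) (x : EG) : EH →L[ℝ] EH :=
  Φ.tangentAut ((extChartAt I (1 : G)).symm x)

theorem chartTangentAut_oneCoord (Φ : LieGroupAction I J G H) :
    Φ.chartTangentAut (oneCoord I G) = ContinuousLinearMap.id ℝ EH := by
  rw [chartTangentAut, extChartAt_symm_oneCoord, tangentAut_one]

variable [I.Boundaryless]

section

variable [IsManifold I ∞ G] [IsManifold J ∞ H]

theorem contDiffAt_chartTangentAut (Φ : LieGroupAction I J G H) :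
    ContDiffAt ℝ ∞ Φ.chartTangentAut (oneCoord I G) := by
  rw [← contMDiffAt_iff_contDiffAt]
  exact Φ.contMDiff_tangentAut.contMDiffAt.comp _ contMDiffAt_extChartAt_symm_oneCoord

theorem differentiated_eq_fderiv (Φ : LieGroupAction I J G H) :
    (Φ.differentiated : EG →L[ℝ] EH →L[ℝ] EH) =
      fderiv ℝ Φ.chartTangentAut (oneCoord I G) :=
  mfderiv_one_eq_fderiv (Φ.mdifferentiableAt_tangentAut 1)

theorem contDiffAt_chartMap₂_act [J.Boundaryless] (Φ : LieGroupAction I J G H) :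
    ContDiffAt ℝ ∞ (chartMap₂ I J J fun g h => Φ.toHom g h) (oneCoord I G, oneCoord J H) :=
  contDiffAt_chartMap₂ (map_one (Φ.toHom 1)) Φ.contMDiff_toHom.contMDiffAt

/-- The differentiated action is the mixed derivative of the action map in the charts. -/
theorem differentiated_eq_mixedFDeriv [J.Boundaryless] (Φ : LieGroupAction I J G H) :
    (Φ.differentiated : EG →L[ℝ] EH →L[ℝ] EH) =
      mixedFDeriv (chartMap₂ I J J fun g h => Φ.toHom g h) (oneCoord I G, oneCoord J H) := by
  rw [← (Φ.contDiffAt_chartMap₂_act.of_le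
    ENat.LEInfty.out).hasFDerivAt_fderiv_mk.fderiv, differentiated_eq_fderiv]
  congr 1
  ext1 x
  exact tangentAtOne_eq_fderiv (map_one (Φ.toHom _))
    ((Φ.contMDiff_act _).contMDiffAt.mdifferentiableAt (by simp))

/-- Equivariant homomorphisms of groups have equivariant tangent maps. -/
theorem tangentAtOne_differentiated (Φ : LieGroupAction I J G H) {ψ : G →* G} {χ : H →* H}
    (hψ : ContMDiff I I ∞ ψ) (hχ : ContMDiff J J ∞ χ)
    (h : ∀ g k, χ (Φ.toHom g k) = Φ.toHom (ψ g) (χ k)) (x : GroupLieAlgebra I G) (v : EH) :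
    (tangentAtOne J J χ : EH →L[ℝ] EH) (Φ.differentiated x v) =
      Φ.differentiated (tangentAtOne I I ψ x : GroupLieAlgebra I G)
        ((tangentAtOne J J χ : EH →L[ℝ] EH) v) := by
  set P : EH →L[ℝ] EH := tangentAtOne J J χ with hP
  have hA : ∀ g, P.comp (Φ.tangentAut g) = (Φ.tangentAut (ψ g)).comp P := by
    intro g
    have h1 := tangentAtOne_comp (map_one (Φ.toHom g))
      ((Φ.contMDiff_act g).contMDiffAt.mdifferentiableAt (by simp))
      (hχ.contMDiffAt.mdifferentiableAt (x := 1) (by simp))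
    have h2 := tangentAtOne_comp (map_one χ)
      (hχ.contMDiffAt.mdifferentiableAt (x := 1) (by simp))
      ((Φ.contMDiff_act (ψ g)).contMDiffAt.mdifferentiableAt (by simp))
    simp only [h] at h1
    exact h1.symm.trans h2
  have hψt : Filter.Tendsto (fun x => ψ ((extChartAt I (1 : G)).symm x)) (𝓝 (oneCoord I G))
      (𝓝 1) := by
    have := hψ.continuous.tendsto 1
    rw [map_one] at this
    exact this.comp tendsto_extChartAt_symm_oneCoord
  have hev : (fun x => P.comp (Φ.chartTangentAut x)) =ᶠ[𝓝 (oneCoord I G)]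
      fun x => (Φ.chartTangentAut (chartMap I I ψ x)).comp P := by
    filter_upwards [eventually_extChartAt_symm_extChartAt (I := I) hψt] with x hx
    simp only [chartTangentAut, chartMap, hx, hA]
  have hd := (Φ.contDiffAt_chartTangentAut.differentiableAt (by simp)).hasFDerivAt
  have hf := ((contDiffAt_chartMap (map_one ψ) hψ.contMDiffAt).differentiableAt
    (by simp)).hasFDerivAt
  have hd' := hd
  rw [← chartMap_oneCoord (I := I) (J := I) (map_one ψ)] at hd'
  -- Differentiate both sides of `hev` at the identity.
  have e1 := (hasFDerivAt_const P (oneCoord I G)).clm_comp hd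
  have e2 := (hd'.comp (oneCoord I G) hf).clm_comp (hasFDerivAt_const P (oneCoord I G))
  have key := e1.unique (e2.congr_of_eventuallyEq hev)
  rw [chartMap_oneCoord (map_one ψ), ← differentiated_eq_fderiv,
    ← tangentAtOne_eq_fderiv (map_one ψ) (hψ.contMDiffAt.mdifferentiableAt (by simp))] at key
  have := congrArg (fun T : EG →L[ℝ] EH →L[ℝ] EH => T x v) key
  simpa using! this

end

variable [LieGroup I ∞ G] [LieGroup J ∞ H]

/-- The differentiated action takes the antisymmetrized mixed derivative of the multiplication of
`G`, which is the bracket of `𝔤`, to the commutator: `g ↦ Φ(g)_{*e}` is multiplicative. -/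
theorem fderiv_chartTangentAut_bracket (Φ : LieGroupAction I J G H) (x y : EG) :
    fderiv ℝ Φ.chartTangentAut (oneCoord I G)
      (mixedFDeriv (chartMul I G) (oneCoord I G, oneCoord I G) x y -
        mixedFDeriv (chartMul I G) (oneCoord I G, oneCoord I G) y x) =
      (fderiv ℝ Φ.chartTangentAut (oneCoord I G) x).comp
          (fderiv ℝ Φ.chartTangentAut (oneCoord I G) y) -
        (fderiv ℝ Φ.chartTangentAut (oneCoord I G) y).comp
          (fderiv ℝ Φ.chartTangentAut (oneCoord I G) x) := by
  have hM := contDiffAt_chartMul (I := I) (G := G)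
  have hint : ∀ᶠ z in 𝓝 (oneCoord I G, oneCoord I G), Φ.chartTangentAut (chartMul I G z) =
      (Φ.chartTangentAut z.1).comp (Φ.chartTangentAut z.2) := by
    have ht : Filter.Tendsto (fun z : EG × EG =>
        (extChartAt I (1 : G)).symm z.1 * (extChartAt I (1 : G)).symm z.2)
        (𝓝 (oneCoord I G, oneCoord I G)) (𝓝 1) := by
      have hc : IsTopologicalGroup G := topologicalGroup_of_lieGroup I ∞
      have h1 := tendsto_extChartAt_symm_oneCoord (I := I) (G := G)
      have h2 := (h1.comp (Filter.tendsto_fst (g := 𝓝 (oneCoord I G)))).mul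
        (h1.comp (Filter.tendsto_snd (f := 𝓝 (oneCoord I G))))
      rwa [mul_one, ← nhds_prod_eq] at h2
    filter_upwards [eventually_extChartAt_symm_extChartAt (I := I) ht] with z hz
    simp only [chartTangentAut, chartMul, chartMap₂, hz, tangentAut_mul]
  have hK : ContDiffAt ℝ 2 (fun z : (EH →L[ℝ] EH) × (EH →L[ℝ] EH) => z.1.comp z.2)
      (Φ.chartTangentAut (oneCoord I G), Φ.chartTangentAut (oneCoord I G)) :=
    contDiffAt_fst.clm_comp contDiffAt_snd
  have key := fderiv_mixedFDeriv_sub_of_intertwines (hM.of_le ENat.LEInfty.out) hK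
    (Φ.contDiffAt_chartTangentAut.of_le ENat.LEInfty.out) eventually_chartMul_oneCoord_right
    eventually_chartMul_oneCoord_left hint x y
  simpa only [mixedFDeriv_clm_comp] using key

/-- The endomorphism `φ(x)` of `𝔥`, with the Lie algebra itself rather than its model space as
domain and target, so that brackets can be formed. -/
noncomputable def differentiatedEnd (Φ : LieGroupAction I J G H) (x : GroupLieAlgebra I G) :
    GroupLieAlgebra J H →ₗ[ℝ] GroupLieAlgebra J H where
  toFun u := Φ.differentiated x u
  map_add' u v := map_add (Φ.differentiated x) u v
  map_smul' c u := map_smul (Φ.differentiated x) c u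

theorem differentiatedEnd_bracket (Φ : LieGroupAction I J G H) (x y : GroupLieAlgebra I G)
    (v : GroupLieAlgebra J H) :
    Φ.differentiatedEnd ⁅x, y⁆ v =
      Φ.differentiatedEnd x (Φ.differentiatedEnd y v) -
        Φ.differentiatedEnd y (Φ.differentiatedEnd x v) := by
  have key := Φ.fderiv_chartTangentAut_bracket x y
  rw [← differentiated_eq_fderiv] at key
  rw [GroupLieAlgebra.bracket_eq_mixedFDeriv]
  exact congrArg (fun T : EH →L[ℝ] EH => T v) key

variable [J.Boundaryless]

/-- Every `φ(x)` is a derivation of the bracket: differentiate the fact that every `Φ(g)_{*e}`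
preserves it. -/
theorem differentiatedEnd_lie [CompleteSpace EH] (Φ : LieGroupAction I J G H)
    (x : GroupLieAlgebra I G) (u v : GroupLieAlgebra J H) :
    Φ.differentiatedEnd x ⁅u, v⁆ = ⁅Φ.differentiatedEnd x u, v⁆ + ⁅u, Φ.differentiatedEnd x v⁆ := by
  let b : EH →L[ℝ] EH →L[ℝ] EH :=
    mixedFDeriv (chartMul J H) (oneCoord J H, oneCoord J H) -
      (mixedFDeriv (chartMul J H) (oneCoord J H, oneCoord J H)).flip
  have hb : ∀ u v : GroupLieAlgebra J H, (⁅u, v⁆ : GroupLieAlgebra J H) = b u v :=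
    GroupLieAlgebra.bracket_eq_mixedFDeriv
  have hA : ∀ x u v, Φ.chartTangentAut x (b u v) =
      b (Φ.chartTangentAut x u) (Φ.chartTangentAut x v) := by
    intro x u v
    have h := tangentAtOne_lie (I := J) (J := J)
      (f := (Φ.toHom ((extChartAt I (1 : G)).symm x)).toMonoidHom) (Φ.contMDiff_act _) u v
    exact (congrArg (Φ.chartTangentAut x) (hb u v)).symm.trans (h.trans (hb _ _))
  have key := fderiv_apply_of_automorphisms
    (Φ.contDiffAt_chartTangentAut.differentiableAt (by simp)) Φ.chartTangentAut_oneCoord hA x u v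
  rw [← differentiated_eq_fderiv] at key
  rw [hb, hb, hb]
  exact key

/-- The differentiated action as a homomorphism of Lie algebras `𝔤 → Der(𝔥)`. -/
noncomputable def toLieDerivation [CompleteSpace EG] [CompleteSpace EH]
    (Φ : LieGroupAction I J G H) :
    GroupLieAlgebra I G →ₗ⁅ℝ⁆ LieDerivation ℝ (GroupLieAlgebra J H) (GroupLieAlgebra J H) where
  toFun x :=
    { Φ.differentiatedEnd x with
      leibniz' := fun u v => by
        rw [← lie_skew v, sub_neg_eq_add, add_comm]
        exact Φ.differentiatedEnd_lie x u v }
  map_add' x y := LieDerivation.ext fun u =>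
    congrArg (fun T : EH →L[ℝ] EH => T u) (map_add Φ.differentiated x y)
  map_smul' c x := LieDerivation.ext fun u =>
    congrArg (fun T : EH →L[ℝ] EH => T u) (map_smul Φ.differentiated c x)
  map_lie' {x y} := LieDerivation.ext fun u => by
    rw [LieDerivation.lie_apply]
    exact Φ.differentiatedEnd_bracket x y u

end LieGroupAction

/-! ### Differentiation of relative Rota-Baxter operators -/

namespace RelRotaBaxterGroup

variable [I.Boundaryless] [J.Boundaryless] [LieGroup I ∞ G] [LieGroup J ∞ H]
  {Φ : LieGroupAction I J G H}

/-- In the charts, the mixed derivative of the descendent product `h * Φ(𝓑 h) k` is that of the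
multiplication of `H` plus `φ(B u) v`. -/
theorem mixedFDeriv_descendent (𝓑 : RelRotaBaxterGroup Φ) (u v : EH) :
    mixedFDeriv (chartMap₂ J J J fun h k => h * Φ.toHom (𝓑.op h) k)
      (oneCoord J H, oneCoord J H) u v =
    mixedFDeriv (chartMul J H) (oneCoord J H, oneCoord J H) u v +
      Φ.differentiated (𝓑.tangent u) v := by
  set α : EH × EH → EH := chartMap₂ J J J fun h k => Φ.toHom (𝓑.op h) k with hα
  have hb := contDiffAt_chartMap (I := J) (J := I) 𝓑.op_one 𝓑.contMDiff_op.contMDiffAt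
  have hbp := chartMap_oneCoord (I := J) (J := I) 𝓑.op_one
  have hact : ContMDiff (J.prod J) J ∞ fun z : H × H => Φ.toHom (𝓑.op z.1) z.2 :=
    Φ.contMDiff_toHom.comp ((𝓑.contMDiff_op.comp contMDiff_fst).prodMk contMDiff_snd)
  have hαs : ContDiffAt ℝ ∞ α (oneCoord J H, oneCoord J H) :=
    contDiffAt_chartMap₂ (map_one _) hact.contMDiffAt
  have htend := tendsto_extChartAt_symm_prod_oneCoord (I := J) (J := J) (G := H) (H := H)
  have hactt : Filter.Tendsto (fun z : H × H => Φ.toHom (𝓑.op z.1) z.2) (𝓝 (1, 1)) (𝓝 1) := by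
    simpa only [map_one] using hact.continuous.tendsto (1, 1)
  have hopt : Filter.Tendsto 𝓑.op (𝓝 1) (𝓝 1) := by
    simpa only [op_one] using 𝓑.contMDiff_op.continuous.tendsto 1
  have hN : (chartMap₂ J J J fun h k => h * Φ.toHom (𝓑.op h) k)
      =ᶠ[𝓝 (oneCoord J H, oneCoord J H)] fun z => chartMul J H (z.1, α z) := by
    filter_upwards [eventually_extChartAt_symm_extChartAt (I := J) (hactt.comp htend)] with z hz
    simp only [Function.comp_apply] at hz
    simp only [hα, chartMul, chartMap₂, hz]
  have hαe : α =ᶠ[𝓝 (oneCoord J H, oneCoord J H)] fun z =>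
      chartMap₂ I J J (fun g h => Φ.toHom g h) (chartMap J I 𝓑.op z.1, z.2) := by
    filter_upwards [eventually_extChartAt_symm_extChartAt (I := I)
      (hopt.comp ((continuous_fst.tendsto _).comp htend))] with z hz
    simp only [Function.comp_apply] at hz
    simp only [hα, chartMap, chartMap₂, hz]
  have hαl : ∀ᶠ x in 𝓝 (oneCoord J H), α (x, oneCoord J H) = oneCoord J H :=
    Filter.Eventually.of_forall fun x => by
      rw [hα, chartMap₂, extChartAt_symm_oneCoord, map_one]
      rfl
  have hαr : ∀ᶠ y in 𝓝 (oneCoord J H), α (oneCoord J H, y) = y := by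
    filter_upwards [eventually_extChartAt_extChartAt_symm (I := J) (G := H)] with y hy
    simp only [hα, chartMap₂, extChartAt_symm_oneCoord, op_one, map_one, MulAut.one_apply, hy]
  have hm := mixedFDeriv_comp_prodMap (K := chartMap₂ I J J fun g h => Φ.toHom g h)
    (f := chartMap J I 𝓑.op) (g := fun y : EH => y) (p := oneCoord J H) (q := oneCoord J H)
    (by rw [hbp]; exact Φ.contDiffAt_chartMap₂_act.of_le ENat.LEInfty.out)
    (hb.of_le ENat.LEInfty.out) contDiffAt_id u v
  rw [hN.mixedFDeriv_eq, mixedFDeriv_mul_act (contDiffAt_chartMul.of_le ENat.LEInfty.out)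
    (hαs.of_le ENat.LEInfty.out) eventually_chartMul_oneCoord_left hαl hαr, hαe.mixedFDeriv_eq]
  refine congrArg₂ (· + ·) rfl (hm.trans ?_)
  rw [hbp, ← Φ.differentiated_eq_mixedFDeriv, ← tangentAtOne_eq_fderiv 𝓑.op_one
    (𝓑.contMDiff_op.contMDiffAt.mdifferentiableAt (by simp)), fderiv_fun_id]
  rfl

variable [CompleteSpace EG] [CompleteSpace EH]

/-- The tangent map of a relative Rota-Baxter operator: `𝓑` is multiplicative for the descendent
product `h * Φ(𝓑 h) k`, whose bracket is `φ(B u) v - φ(B v) u + [u, v]`. -/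
theorem isRelRotaBaxter_tangent (𝓑 : RelRotaBaxterGroup Φ) :
    IsRelRotaBaxter Φ.toLieDerivation (𝓑.tangent : GroupLieAlgebra J H →ₗ[ℝ] _) := by
  intro u v
  -- `𝓑` takes the descendent product to the multiplication of `G`.
  have hact : ContMDiff (J.prod J) J ∞ fun z : H × H => z.1 * Φ.toHom (𝓑.op z.1) z.2 :=
    contMDiff_fst.mul (Φ.contMDiff_toHom.comp
      ((𝓑.contMDiff_op.comp contMDiff_fst).prodMk contMDiff_snd))
  have key := tangentAtOne_mixedFDeriv_sub (I := I) (J := J)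
    (n := fun h k : H => h * Φ.toHom (𝓑.op h) k) (f := 𝓑.op) hact.contMDiffAt
    (fun h => by simp) (fun h => by simp [op_one]) 𝓑.op_one 𝓑.contMDiff_op.contMDiffAt
    (fun h k => (𝓑.op_mul_op h k).symm) u v
  have hbr : ∀ u v : EH,
      mixedFDeriv (chartMap₂ J J J fun h k => h * Φ.toHom (𝓑.op h) k)
          (oneCoord J H, oneCoord J H) u v -
        mixedFDeriv (chartMap₂ J J J fun h k => h * Φ.toHom (𝓑.op h) k)
          (oneCoord J H, oneCoord J H) v u =
      Φ.differentiated (𝓑.tangent u) v - Φ.differentiated (𝓑.tangent v) u +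
        (mixedFDeriv (chartMul J H) (oneCoord J H, oneCoord J H) u v -
          mixedFDeriv (chartMul J H) (oneCoord J H, oneCoord J H) v u) := by
    intro u v
    rw [mixedFDeriv_descendent, mixedFDeriv_descendent]
    abel
  rw [GroupLieAlgebra.bracket_eq_mixedFDeriv u v]
  exact key.symm.trans (congrArg (tangentAtOne J I 𝓑.op : EH →L[ℝ] EG) (hbr u v))

/-- Differentiation of relative Rota-Baxter operators and of their homomorphisms. -/
noncomputable def diff : RelRotaBaxterGroup Φ ⥤ RelRotaBaxter Φ.toLieDerivation where
  obj 𝓑 := ⟨(𝓑.tangent : GroupLieAlgebra J H →ₗ[ℝ] _), 𝓑.isRelRotaBaxter_tangent⟩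
  map {𝓑' 𝓑} Ψ :=
    { onTarget := tangentLieHom Ψ.onTarget Ψ.contMDiff_onTarget
      onSource := tangentLieHom Ψ.onSource Ψ.contMDiff_onSource
      isHom := by
        refine ⟨fun u => ?_, fun x v => Φ.tangentAtOne_differentiated Ψ.contMDiff_onTarget
          Ψ.contMDiff_onSource Ψ.onSource_act x v⟩
        have h1 := tangentAtOne_comp 𝓑'.op_one
          (𝓑'.contMDiff_op.contMDiffAt.mdifferentiableAt (by simp))
          (Ψ.contMDiff_onTarget.contMDiffAt.mdifferentiableAt (x := 1) (by simp))
        have h2 := tangentAtOne_comp (map_one Ψ.onSource)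
          (Ψ.contMDiff_onSource.contMDiffAt.mdifferentiableAt (x := 1) (by simp))
          (𝓑.contMDiff_op.contMDiffAt.mdifferentiableAt (x := 1) (by simp))
        simp only [Ψ.op_onSource] at h2
        exact congrArg (fun T : EH →L[ℝ] EG => T u) (h1.symm.trans h2) }
  map_id 𝓑 := RelRotaBaxter.Hom.ext
    (LieHom.ext fun x => congrArg (fun T : EG →L[ℝ] EG => T x) tangentAtOne_id)
    (LieHom.ext fun u => congrArg (fun T : EH →L[ℝ] EH => T u) tangentAtOne_id)
  map_comp Ψ Ψ' := RelRotaBaxter.Hom.ext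
    (LieHom.ext fun x => congrArg (fun T : EG →L[ℝ] EG => T x)
      (tangentAtOne_comp (map_one Ψ.onTarget)
        (Ψ.contMDiff_onTarget.contMDiffAt.mdifferentiableAt (x := 1) (by simp))
        (Ψ'.contMDiff_onTarget.contMDiffAt.mdifferentiableAt (x := 1) (by simp))))
    (LieHom.ext fun u => congrArg (fun T : EH →L[ℝ] EH => T u)
      (tangentAtOne_comp (map_one Ψ.onSource)
        (Ψ.contMDiff_onSource.contMDiffAt.mdifferentiableAt (x := 1) (by simp))
        (Ψ'.contMDiff_onSource.contMDiffAt.mdifferentiableAt (x := 1) (by simp))))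

end RelRotaBaxterGroup

end Action

theorem mainTheorem3
    {EG : Type*} [NormedAddCommGroup EG] [NormedSpace ℝ EG] [CompleteSpace EG]
    {MG : Type*} [TopologicalSpace MG] (I : ModelWithCorners ℝ EG MG) [I.Boundaryless]
    {EH : Type*} [NormedAddCommGroup EH] [NormedSpace ℝ EH] [CompleteSpace EH]
    {MH : Type*} [TopologicalSpace MH] (J : ModelWithCorners ℝ EH MH) [J.Boundaryless]
    (G : Type*) [TopologicalSpace G] [ChartedSpace MG G] [Group G] [LieGroup I ∞ G]
    (H : Type*) [TopologicalSpace H] [ChartedSpace MH H] [Group H] [LieGroup J ∞ H]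
    (Φ : LieGroupAction I J G H) :
    ContMDiff I 𝓘(ℝ, EH →L[ℝ] EH) ∞ Φ.tangentAut ∧
    ∃ φ : GroupLieAlgebra I G →ₗ⁅ℝ⁆
        LieDerivation ℝ (GroupLieAlgebra J H) (GroupLieAlgebra J H),
      (∀ (x : GroupLieAlgebra I G) (u : GroupLieAlgebra J H), φ x u = Φ.differentiated x u) ∧
      (∀ 𝓑 : RelRotaBaxterGroup Φ, IsRelRotaBaxter φ (𝓑.tangent : _ →ₗ[ℝ] _)) ∧
      ∃ Diff : RelRotaBaxterGroup Φ ⥤ RelRotaBaxter φ,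
        (∀ 𝓑 : RelRotaBaxterGroup Φ, (Diff.obj 𝓑).op = (𝓑.tangent : _ →ₗ[ℝ] _)) ∧
        ∀ (𝓑' 𝓑 : RelRotaBaxterGroup Φ) (Ψ : 𝓑' ⟶ 𝓑),
          (∀ x, (Diff.map Ψ).onTarget x = tangentAtOne I I Ψ.onTarget x) ∧
          ∀ u, (Diff.map Ψ).onSource u = tangentAtOne J J Ψ.onSource u := by
  exact ⟨Φ.contMDiff_tangentAut, Φ.toLieDerivation, fun _ _ => rfl,
    fun 𝓑 => 𝓑.isRelRotaBaxter_tangent, RelRotaBaxterGroup.diff, fun _ => rfl,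
    fun _ _ _ => ⟨fun _ => rfl, fun _ => rfl⟩⟩
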